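/- **Theorem (Heisenberg inequalities for qr-numbers).** Let $U$ be a strongly continuous unitary representation of a finite-dimensional real Lie group $G$, with Lie algebra $\mathfrak g$, on a separable complex Hilbert space $\mathcal H$. Let $\mathcal D=\mathcal D^\infty(U)$ be the space of vectors $\varphi$ for which $g\mapsto U(g)\varphi$ is smooth, let $dU(x)\varphi=\frac{d}{dt}U(\exp tx)\varphi|_{t=0}$ for $x\in\mathfrak g$, $\varphi\in\mathcal D$, and let $\mathcal A=dU(\mathcal E(\mathfrak g))$ be the algebra of operators on $\mathcal D$ that is the image of the complex universal enveloping algebra of $\mathfrak g$ under the extension of $dU$. A *state* is a positive operator $\rho$ of trace $1$ on $\mathcal H$ that lies in $\mathcal T_1(\mathcal A)$: a bounded operator $T$ lies in $\mathcal T_1(\mathcal A)$ if it is trace class, $T\mathcal H\subseteq\mathcal D$, $T^*\mathcal H\subseteq\mathcal D$, and $\hat AT,\hat AT^*$ are trace class for every $\hat A\in\mathcal A$. The state space carries the weak topology, with open sub-base the sets $\{\rho:|\mathrm{Tr}\,\hat A\rho-\mathrm{Tr}\,\hat A\rho_0|<\delta\}$ ($\hat A\in\mathcal A$, $\rho_0$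 a state, $\delta>0$). A *condition* is an open set $W$ of states. For symmetric $\hat A\in\mathcal A$ the qr-number $a_Q(W)$ is the continuous real function $\rho\mapsto\mathrm{Tr}\,\hat A\rho$ on $W$, $a^2_Q(W)$ is that of $\hat A^2$, and $s(a)_Q(W)=\sqrt{a^2_Q(W)-a_Q(W)^2}$; (in)equalities between such functions hold pointwise on $W$. Let $0<\epsilon<1$. For a bounded closed interval $I_a$ with midpoint $a_0$ and width $|I_a|$, $\hat A$ is *$\epsilon$-sharp collimated in $I_a$ in the condition $W$* if $$|a_Q(W)-a_0|\le \tfrac{\epsilon}{2}|I_a|\quad\text{and}\quad a_0-\tfrac{|I_a|}2\le a_Q(W)-\frac{s(a)_Q(W)}{\sqrt\epsilon}\le a_Q(W)+\frac{s(a)_Q(W)}{\sqrt\epsilon}\le a_0+\tfrac{|I_a|}2 .$$ Let $\hat A,\hat B,\hat C\in\mathcal A$ with $\hat A,\hat B$ essentially self-adjoint on $\mathcal D$ and $i\hat C=[\hat A,\hat B]$. If $\hat A$ is $\epsilon$-sharp collimated in $I_a$ and $\hat B$ is $\epsilon$-sharp collimated in $I_b$ in the condition $W$, then $$|I_a|\,|I_b|\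 \ge\ \frac{2\,|c_Q(W)|}{\epsilon}.$$ The same inequality holds if, for both operators, collimation is only required in the weaker sense $a_Q(W)\in I_a$ and $a^2_Q(W)-a_Q(W)^2\le\frac{\epsilon}{4}|I_a|^2$ (and likewise for $\hat B$, $I_b$). -/

import Mathlib

open scoped Manifold ContDiff InnerProductSpace TensorProduct

noncomputable section
namespace QR
attribute [local instance] LieRing.ofAssociativeRing

/-! ### Differentiating along a Lie bracket of vector fields -/

instance completeSpace_of_finiteDimensional {E : Type*} [NormedAddCommGroup E]
    [NormedSpace ℝ E] [FiniteDimensional ℝ E] : CompleteSpace E :=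
  FiniteDimensional.complete ℝ E

section Bracket
open VectorField Set
variable {E : Type*} [NormedAddCommGroup E] [NormedSpace ℝ E]
  {M : Type*} [TopologicalSpace M] [ChartedSpace E M] [IsManifold 𝓘(ℝ, E) ∞ M]
  {F : Type*} [NormedAddCommGroup F] [NormedSpace ℝ F]

theorem fderiv_comp_chart (x₀ : M) {h : M → F} {y : E}
    (hy : y ∈ (extChartAt 𝓘(ℝ, E) x₀).target)
    (hh : MDifferentiableAt 𝓘(ℝ, E) 𝓘(ℝ, F) h ((extChartAt 𝓘(ℝ, E) x₀).symm y))
    (V : Π x : M, TangentSpace 𝓘(ℝ, E) x) :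
    (fderiv ℝ (h ∘ (extChartAt 𝓘(ℝ, E) x₀).symm) y
      (mpullbackWithin 𝓘(ℝ, E) 𝓘(ℝ, E) (extChartAt 𝓘(ℝ, E) x₀).symm V
        (range 𝓘(ℝ, E)) y : E)) =
      mfderiv 𝓘(ℝ, E) 𝓘(ℝ, F) h ((extChartAt 𝓘(ℝ, E) x₀).symm y)
        (V ((extChartAt 𝓘(ℝ, E) x₀).symm y)) := by
  have hinv := isInvertible_mfderivWithin_extChartAt_symm (I := 𝓘(ℝ, E)) hy
  have hs := mdifferentiableWithinAt_extChartAt_symm (I := 𝓘(ℝ, E)) hy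
  simp only [mpullbackWithin_apply, modelWithCornersSelf_coe, range_id, mfderivWithin_univ,
    mdifferentiableWithinAt_univ] at hinv hs ⊢
  rw [← mfderiv_eq_fderiv, mfderiv_comp y hh hs]
  obtain ⟨e, he⟩ := hinv
  rw [← he, ContinuousLinearMap.inverse_equiv]
  exact congrArg (mfderiv 𝓘(ℝ, E) 𝓘(ℝ, F) h _) (e.apply_symm_apply _)

/-- `[V, W] h = V (W h) - W (V h)` for a smooth vector-valued function `h` on a manifold. -/
theorem mfderiv_mlieBracket [CompleteSpace E] (x₀ : M) {h : M → F} (hh : ContMDiff 𝓘(ℝ, E) 𝓘(ℝ, F) ∞ h)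
    {V W : Π x : M, TangentSpace 𝓘(ℝ, E) x}
    (hV : MDifferentiableAt 𝓘(ℝ, E) 𝓘(ℝ, E).tangent
      (fun x => (V x : TangentBundle 𝓘(ℝ, E) M)) x₀)
    (hW : MDifferentiableAt 𝓘(ℝ, E) 𝓘(ℝ, E).tangent
      (fun x => (W x : TangentBundle 𝓘(ℝ, E) M)) x₀)
    {hVh hWh : M → F}
    (eV : ∀ x, hVh x = mfderiv 𝓘(ℝ, E) 𝓘(ℝ, F) h x (V x))
    (eW : ∀ x, hWh x = mfderiv 𝓘(ℝ, E) 𝓘(ℝ, F) h x (W x))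
    (dV : MDifferentiableAt 𝓘(ℝ, E) 𝓘(ℝ, F) hVh x₀)
    (dW : MDifferentiableAt 𝓘(ℝ, E) 𝓘(ℝ, F) hWh x₀)
    {a b c : F} (ha : a = mfderiv 𝓘(ℝ, E) 𝓘(ℝ, F) h x₀ (mlieBracket 𝓘(ℝ, E) V W x₀))
    (hb : b = mfderiv 𝓘(ℝ, E) 𝓘(ℝ, F) hWh x₀ (V x₀))
    (hc : c = mfderiv 𝓘(ℝ, E) 𝓘(ℝ, F) hVh x₀ (W x₀)) : a = b - c := by
  have : IsManifold 𝓘(ℝ, E) 2 M := IsManifold.of_le (n := ∞) ENat.LEInfty.out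
  set ψ := extChartAt 𝓘(ℝ, E) x₀ with hψ
  set y₀ := ψ x₀ with hy₀
  have hx₀ : ψ.symm y₀ = x₀ := extChartAt_to_inv x₀
  have hy : y₀ ∈ ψ.target := mem_extChartAt_target x₀
  have ht : ψ.target ∈ nhds y₀ := extChartAt_target_mem_nhds x₀
  let V' : E → E := mpullbackWithin 𝓘(ℝ, E) 𝓘(ℝ, E) ψ.symm V (range 𝓘(ℝ, E))
  let W' : E → E := mpullbackWithin 𝓘(ℝ, E) 𝓘(ℝ, E) ψ.symm W (range 𝓘(ℝ, E))
  have hV' : DifferentiableAt ℝ V' y₀ := by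
    refine DifferentiableWithinAt.differentiableAt (s := ψ.symm ⁻¹' univ ∩ range 𝓘(ℝ, E))
      (MDifferentiableWithinAt.differentiableWithinAt_mpullbackWithin_vectorField
        hV.mdifferentiableWithinAt) (by simp)
  have hW' : DifferentiableAt ℝ W' y₀ := by
    refine DifferentiableWithinAt.differentiableAt (s := ψ.symm ⁻¹' univ ∩ range 𝓘(ℝ, E))
      (MDifferentiableWithinAt.differentiableWithinAt_mpullbackWithin_vectorField
        hW.mdifferentiableWithinAt) (by simp)
  let f : E → F := h ∘ ψ.symm
  have hf : ContDiffAt ℝ ∞ f y₀ := by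
    have h1 : ContMDiffAt 𝓘(ℝ, E) 𝓘(ℝ, E) ∞ ψ.symm y₀ :=
      (contMDiffOn_extChartAt_symm x₀).contMDiffAt ht
    exact ((hh (ψ.symm y₀)).comp y₀ h1).contDiffAt
  have hmd : ∀ x, MDifferentiableAt 𝓘(ℝ, E) 𝓘(ℝ, F) h x := fun x =>
    hh.mdifferentiableAt (by simp)
  have key : ∀ X : Π x : M, TangentSpace 𝓘(ℝ, E) x, ∀ k : M → F,
      (∀ x, k x = mfderiv 𝓘(ℝ, E) 𝓘(ℝ, F) h x (X x)) →
      k ∘ ψ.symm =ᶠ[nhds y₀] fun y => fderiv ℝ f y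
        (mpullbackWithin 𝓘(ℝ, E) 𝓘(ℝ, E) ψ.symm X (range 𝓘(ℝ, E)) y : E) := by
    intro X k hk
    filter_upwards [ht] with y hy
    rw [fderiv_comp_chart x₀ hy (hmd _) X]
    exact hk _
  have hf' : DifferentiableAt ℝ (fderiv ℝ f) y₀ :=
    (hf.fderiv_right (m := 1) (by norm_cast)).differentiableAt (by simp)
  have hsymm : IsSymmSndFDerivAt ℝ f y₀ := hf.isSymmSndFDerivAt (by simpa using ENat.LEInfty.out)
  have cW := fderiv_comp_chart x₀ hy (h := hWh) (by rwa [hx₀]) V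
  have cV := fderiv_comp_chart x₀ hy (h := hVh) (by rwa [hx₀]) W
  have cB := fderiv_comp_chart x₀ hy (h := h) (hmd _) (mlieBracket 𝓘(ℝ, E) V W)
  rw [← hψ, hx₀] at cW cV cB
  rw [ha, hb, hc, ← cB, ← cW, ← cV, (key W hWh eW).fderiv_eq, (key V hVh eV).fderiv_eq]
  have hB : (mpullbackWithin 𝓘(ℝ, E) 𝓘(ℝ, E) ψ.symm (mlieBracket 𝓘(ℝ, E) V W)
      (range 𝓘(ℝ, E)) y₀ : E) = fderiv ℝ W' y₀ (V' y₀) - fderiv ℝ V' y₀ (W' y₀) := by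
    have e0 : ∀ s : Set E, s = univ → lieBracketWithin ℝ V' W' s y₀ =
        fderiv ℝ W' y₀ (V' y₀) - fderiv ℝ V' y₀ (W' y₀) := by
      rintro s rfl
      rw [lieBracketWithin_univ]
      rfl
    have e1 : mlieBracket 𝓘(ℝ, E) V W x₀ = (mfderiv 𝓘(ℝ, E) 𝓘(ℝ, E) ψ x₀).inverse
        (fderiv ℝ W' y₀ (V' y₀) - fderiv ℝ V' y₀ (W' y₀)) :=
      congrArg (mfderiv 𝓘(ℝ, E) 𝓘(ℝ, E) ψ x₀).inverse
        (e0 (ψ.symm ⁻¹' univ ∩ range 𝓘(ℝ, E)) (by simp))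
    have e2 : (mfderivWithin 𝓘(ℝ, E) 𝓘(ℝ, E) ψ.symm (range 𝓘(ℝ, E)) y₀) ∘L
        (mfderiv 𝓘(ℝ, E) 𝓘(ℝ, E) ψ x₀) = ContinuousLinearMap.id ℝ _ :=
      mfderivWithin_extChartAt_symm_comp_mfderiv_extChartAt' (I := 𝓘(ℝ, E))
        (mem_extChartAt_source x₀)
    have e3 : ∀ P Q : E →L[ℝ] E, P.IsInvertible → Q.IsInvertible →
        P ∘L Q = ContinuousLinearMap.id ℝ E → ∀ v, P.inverse (Q.inverse v) = v := by
      rintro _ _ ⟨p, rfl⟩ ⟨q, rfl⟩ hpq v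
      rw [ContinuousLinearMap.inverse_equiv, ContinuousLinearMap.inverse_equiv]
      apply p.injective
      simpa using (congrArg (fun T : E →L[ℝ] E => T (q.symm v)) hpq).symm
    have e4 : (mlieBracket 𝓘(ℝ, E) V W (ψ.symm y₀) : E) = mlieBracket 𝓘(ℝ, E) V W x₀ :=
      congrArg (fun z => (mlieBracket 𝓘(ℝ, E) V W z : E)) hx₀
    exact (congrArg (mfderivWithin 𝓘(ℝ, E) 𝓘(ℝ, E) ψ.symm (range 𝓘(ℝ, E)) y₀).inverse
      (e4.trans e1)).trans (e3 _ _ (isInvertible_mfderivWithin_extChartAt_symm hy)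
        (isInvertible_mfderiv_extChartAt (mem_extChartAt_source x₀)) e2 _)
  rw [hB]
  change _ = fderiv ℝ (fun y => fderiv ℝ f y (W' y)) y₀ (V' y₀) -
    fderiv ℝ (fun y => fderiv ℝ f y (V' y)) y₀ (W' y₀)
  rw [fderiv_clm_apply hf' hW', fderiv_clm_apply hf' hV']
  have := hsymm (V' y₀) (W' y₀)
  change _ = (fderiv ℝ f y₀ _ + _) - (fderiv ℝ f y₀ _ + _)
  simp [this]
  rfl


end Bracket

/-! ### The infinitesimal representation of a unitary representation -/

section Rep
variable {E : Type*} [NormedAddCommGroup E] [NormedSpace ℝ E]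
  {G : Type*} [TopologicalSpace G] [ChartedSpace E G] [Group G]
  {H : Type*} [NormedAddCommGroup H] [InnerProductSpace ℂ H]

/-- A strongly continuous unitary representation of `G` on the Hilbert space `H`. -/
structure UnitaryRep (G : Type*) [TopologicalSpace G] [Group G]
    (H : Type*) [NormedAddCommGroup H] [InnerProductSpace ℂ H] where
  toHom : G →* (H ≃ₗᵢ[ℂ] H)
  continuous_orbit : ∀ φ : H, Continuous fun g => toHom g φ

/-- The space `D^∞(U)` of smooth vectors: those `φ` for which `g ↦ U(g) φ` is a smooth map from
the Lie group `G` (modelled on `E`) to `H`. -/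
def UnitaryRep.smoothVectors (E : Type*) [NormedAddCommGroup E] [NormedSpace ℝ E]
    [ChartedSpace E G] (U : UnitaryRep G H) : Submodule ℂ H where
  carrier := {φ | ContMDiff 𝓘(ℝ, E) 𝓘(ℝ, H) ∞ fun g => U.toHom g φ}
  zero_mem' := by
    simpa using (contMDiff_const : ContMDiff 𝓘(ℝ, E) 𝓘(ℝ, H) ∞ fun _ : G => (0 : H))
  add_mem' := by
    intro φ ψ hφ hψ
    simpa using! ContMDiff.add hφ hψ
  smul_mem' := by
    intro c φ hφ
    have h : ContMDiff 𝓘(ℝ, H) 𝓘(ℝ, H) ∞ fun x : H => c • x :=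
      (contDiff_id.const_smul c).contMDiff
    simpa using! h.comp hφ

/-- The derivative at the identity of `g ↦ U(g) φ` in the direction `x` of the Lie algebra. By
`hasDerivAt_derivVec` it is `d/dt U(γ t) φ` at `t = 0` for every curve `γ` through the identity with
velocity `x`, in particular for `γ t = exp (t x)`. -/
def UnitaryRep.derivVec (U : UnitaryRep G H) (x : GroupLieAlgebra 𝓘(ℝ, E) G) (φ : H) : H :=
  mfderiv 𝓘(ℝ, E) 𝓘(ℝ, H) (fun g => U.toHom g φ) 1 x

theorem UnitaryRep.hasDerivAt_derivVec (U : UnitaryRep G H) (x : GroupLieAlgebra 𝓘(ℝ, E) G)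
    {φ : H} (hφ : φ ∈ U.smoothVectors E) (γ : ℝ → G) (h0 : γ 0 = 1)
    (hγ : MDifferentiableAt 𝓘(ℝ, ℝ) 𝓘(ℝ, E) γ 0)
    (hx : (mfderiv 𝓘(ℝ, ℝ) 𝓘(ℝ, E) γ 0 (1 : ℝ) : E) = x) :
    HasDerivAt (fun t => U.toHom (γ t) φ) (U.derivVec x φ) 0 := by
  have hf : MDifferentiableAt 𝓘(ℝ, E) 𝓘(ℝ, H) (fun g => U.toHom g φ) (γ 0) :=
    hφ.mdifferentiableAt (by simp)
  have h : HasMFDerivAt 𝓘(ℝ, ℝ) 𝓘(ℝ, H) (fun t => U.toHom (γ t) φ) 0 _ :=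
    hf.hasMFDerivAt.comp 0 hγ.hasMFDerivAt
  have h2 := h.mdifferentiableAt.differentiableAt.hasDerivAt
  have e : deriv (fun t => U.toHom (γ t) φ) 0 = U.derivVec x φ := by
    rw [← fderiv_apply_one_eq_deriv, ← mfderiv_eq_fderiv, h.mfderiv, UnitaryRep.derivVec, ← h0,
      ← hx]
    rfl
  rwa [e] at h2

variable [LieGroup 𝓘(ℝ, E) ∞ G]

theorem UnitaryRep.apply_derivVec (U : UnitaryRep G H) (x : GroupLieAlgebra 𝓘(ℝ, E) G)
    {φ : H} (hφ : φ ∈ U.smoothVectors E) (g : G) :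
    U.toHom g (U.derivVec x φ) =
      mfderiv 𝓘(ℝ, E) 𝓘(ℝ, H) (fun g => U.toHom g φ) g (mulInvariantVectorField x g) := by
  have hf : MDifferentiableAt 𝓘(ℝ, E) 𝓘(ℝ, H) (fun g => U.toHom g φ) (g * 1) :=
    hφ.mdifferentiableAt (by simp)
  have hf1 : MDifferentiableAt 𝓘(ℝ, E) 𝓘(ℝ, H) (fun g => U.toHom g φ) (1 : G) :=
    hφ.mdifferentiableAt (by simp)
  have hl : MDifferentiableAt 𝓘(ℝ, E) 𝓘(ℝ, E) (fun h => g * h) (1 : G) :=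
    (contMDiff_mul_left (I := 𝓘(ℝ, E)) (n := ∞)).mdifferentiableAt (by simp)
  have hL : HasFDerivAt (U.toHom g : H → H)
      ((U.toHom g).toLinearIsometry.toContinuousLinearMap.restrictScalars ℝ)
      (U.toHom 1 φ) :=
    ((U.toHom g).toLinearIsometry.toContinuousLinearMap.restrictScalars ℝ).hasFDerivAt
  have h1 := hL.hasMFDerivAt.comp (1 : G) hf1.hasMFDerivAt
  have h2 := hf.hasMFDerivAt.comp (1 : G) hl.hasMFDerivAt
  have e : (U.toHom g : H → H) ∘ (fun h => U.toHom h φ)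
      = (fun h => U.toHom h φ) ∘ (fun h : G => g * h) := by
    funext h; simp
  rw [e] at h1
  have h3 := congrArg (fun T : E →L[ℝ] H => T x) (h1.mfderiv.symm.trans h2.mfderiv)
  rw [mul_one] at h3
  exact h3

theorem contMDiff_mulInvariantVectorField_infty (v : GroupLieAlgebra 𝓘(ℝ, E) G) :
    ContMDiff 𝓘(ℝ, E) 𝓘(ℝ, E).tangent ∞
      (fun g : G => (mulInvariantVectorField v g : TangentBundle 𝓘(ℝ, E) G)) := by
  let fg : G → TangentBundle 𝓘(ℝ, E) G := fun g => Bundle.TotalSpace.mk' E g 0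
  have sfg : ContMDiff 𝓘(ℝ, E) 𝓘(ℝ, E).tangent ∞ fg := Bundle.contMDiff_zeroSection _ _
  let fv : G → TangentBundle 𝓘(ℝ, E) G := fun _ => Bundle.TotalSpace.mk' E 1 v
  have sfv : ContMDiff 𝓘(ℝ, E) 𝓘(ℝ, E).tangent ∞ fv := contMDiff_const
  let F₁ : G → (TangentBundle 𝓘(ℝ, E) G × TangentBundle 𝓘(ℝ, E) G) := fun g => (fg g, fv g)
  have S₁ : ContMDiff 𝓘(ℝ, E) (𝓘(ℝ, E).tangent.prod 𝓘(ℝ, E).tangent) ∞ F₁ := sfg.prodMk sfv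
  let F₂ := (equivTangentBundleProd 𝓘(ℝ, E) G 𝓘(ℝ, E) G).symm
  have S₂ : ContMDiff (𝓘(ℝ, E).tangent.prod 𝓘(ℝ, E).tangent)
      (𝓘(ℝ, E).prod 𝓘(ℝ, E)).tangent ∞ F₂ := contMDiff_equivTangentBundleProd_symm
  let F₃ : TangentBundle (𝓘(ℝ, E).prod 𝓘(ℝ, E)) (G × G) → TangentBundle 𝓘(ℝ, E) G :=
    tangentMap (𝓘(ℝ, E).prod 𝓘(ℝ, E)) 𝓘(ℝ, E) (fun p : G × G => p.1 * p.2)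
  have S₃ : ContMDiff (𝓘(ℝ, E).prod 𝓘(ℝ, E)).tangent 𝓘(ℝ, E).tangent ∞ F₃ :=
    ContMDiff.contMDiff_tangentMap (contMDiff_mul 𝓘(ℝ, E) ∞) (by simp)
  have S := (S₃.comp S₂).comp S₁
  convert! S with g
  · simp [F₁, F₂, F₃, fg, fv]
  · simp only [Function.comp_apply, tangentMap, F₃, F₂, F₁, fg, fv]
    rw [mfderiv_prod_eq_add_apply ((contMDiff_mul 𝓘(ℝ, E) ∞).mdifferentiableAt (by simp))]
    exact (((congrArg (· + (mfderiv 𝓘(ℝ, E) 𝓘(ℝ, E) (fun z : G => g * z) 1 v : E))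
      (map_zero (mfderiv 𝓘(ℝ, E) 𝓘(ℝ, E) (fun z : G => z * 1) g))).trans
        (zero_add (mfderiv 𝓘(ℝ, E) 𝓘(ℝ, E) (fun z : G => g * z) 1 v : E)))).symm

theorem UnitaryRep.derivVec_mem (U : UnitaryRep G H) (x : GroupLieAlgebra 𝓘(ℝ, E) G)
    {φ : H} (hφ : φ ∈ U.smoothVectors E) : U.derivVec x φ ∈ U.smoothVectors E := by
  have S : ContMDiff 𝓘(ℝ, E) 𝓘(ℝ, H).tangent ∞ fun g : G =>
      tangentMap 𝓘(ℝ, E) 𝓘(ℝ, H) (fun g => U.toHom g φ)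
        (mulInvariantVectorField x g : TangentBundle 𝓘(ℝ, E) G) :=
    (ContMDiff.contMDiff_tangentMap hφ (by simp)).comp (contMDiff_mulInvariantVectorField_infty x)
  have T := (contMDiff_snd_tangentBundle_modelSpace H 𝓘(ℝ, H)).comp S
  have e : (fun g : G => U.toHom g (U.derivVec x φ)) = fun g : G =>
      mfderiv 𝓘(ℝ, E) 𝓘(ℝ, H) (fun g => U.toHom g φ) g (mulInvariantVectorField x g) :=
    funext fun g => U.apply_derivVec x hφ g
  change ContMDiff 𝓘(ℝ, E) 𝓘(ℝ, H) ∞ fun g : G => U.toHom g (U.derivVec x φ)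
  rw [e]
  exact T

/-- The operator `dU(x)` on `D^∞(U)`, for `x` in the Lie algebra of `G`. -/
def UnitaryRep.infinitesimal (U : UnitaryRep G H) (x : GroupLieAlgebra 𝓘(ℝ, E) G) :
    Module.End ℂ (U.smoothVectors E) where
  toFun φ := ⟨U.derivVec x φ, U.derivVec_mem x φ.2⟩
  map_add' φ ψ := by
    apply Subtype.ext
    have hφ : MDifferentiableAt 𝓘(ℝ, E) 𝓘(ℝ, H) (fun g => U.toHom g φ) (1 : G) :=
      φ.2.mdifferentiableAt (by simp)
    have hψ : MDifferentiableAt 𝓘(ℝ, E) 𝓘(ℝ, H) (fun g => U.toHom g ψ) (1 : G) :=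
      ψ.2.mdifferentiableAt (by simp)
    have h := (hφ.hasMFDerivAt.add hψ.hasMFDerivAt).mfderiv
    have e : ((fun g => U.toHom g φ) + fun g => U.toHom g ψ) =
        fun g : G => U.toHom g ((φ + ψ : U.smoothVectors E) : H) := by
      funext g; simp
    rw [e] at h
    exact congrArg (fun T : E →L[ℝ] H => T x) h
  map_smul' c φ := by
    apply Subtype.ext
    have hφ : MDifferentiableAt 𝓘(ℝ, E) 𝓘(ℝ, H) (fun g => U.toHom g φ) (1 : G) :=
      φ.2.mdifferentiableAt (by simp)
    have hL : HasFDerivAt (fun v : H => c • v)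
        ((c • ContinuousLinearMap.id ℂ H).restrictScalars ℝ) (U.toHom 1 φ) :=
      ((c • ContinuousLinearMap.id ℂ H).restrictScalars ℝ).hasFDerivAt
    have h := (hL.hasMFDerivAt.comp (1 : G) hφ.hasMFDerivAt).mfderiv
    have e : ((fun v : H => c • v) ∘ fun g => U.toHom g φ) =
        fun g : G => U.toHom g ((c • φ : U.smoothVectors E) : H) := by
      funext g; simp
    rw [e] at h
    exact congrArg (fun T : E →L[ℝ] H => T x) h

theorem UnitaryRep.coe_infinitesimal_apply (U : UnitaryRep G H) (x : GroupLieAlgebra 𝓘(ℝ, E) G)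
    (φ : U.smoothVectors E) : (U.infinitesimal x φ : H) = U.derivVec x φ := rfl

instance instLieGroupMinSmoothness : LieGroup 𝓘(ℝ, E) (minSmoothness ℝ 3) G := by
  rw [minSmoothness_of_isRCLikeNormedField]
  infer_instance

variable [FiniteDimensional ℝ E]

/-- `x ↦ dU(x)` as a representation of the Lie algebra of `G` on `D^∞(U)`. -/
def UnitaryRep.lieHom (U : UnitaryRep G H) :
    GroupLieAlgebra 𝓘(ℝ, E) G →ₗ⁅ℝ⁆ Module.End ℂ (U.smoothVectors E) where
  toFun := U.infinitesimal
  map_add' x y := by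
    ext φ
    exact map_add (mfderiv 𝓘(ℝ, E) 𝓘(ℝ, H) (fun g => U.toHom g (φ : H)) (1 : G)) x y
  map_smul' c x := by
    ext φ
    exact map_smul (mfderiv 𝓘(ℝ, E) 𝓘(ℝ, H) (fun g => U.toHom g (φ : H)) (1 : G)) c x
  map_lie' := by
    intro x y
    ext φ
    have hd : ∀ (z : GroupLieAlgebra 𝓘(ℝ, E) G) (ψ : U.smoothVectors E),
        MDifferentiableAt 𝓘(ℝ, E) 𝓘(ℝ, H) (fun g => U.toHom g (U.derivVec z ψ)) (1 : G) :=
      fun z ψ => (U.derivVec_mem z ψ.2).mdifferentiableAt (by simp)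
    have one : ∀ z : GroupLieAlgebra 𝓘(ℝ, E) G, mulInvariantVectorField z (1 : G) = z := by
      intro z
      have e : (fun h : G => 1 * h) = id := by funext h; simp
      rw [mulInvariantVectorField, e, mfderiv_id]
      rfl
    exact mfderiv_mlieBracket (M := G) 1 φ.2
      (mdifferentiableAt_mulInvariantVectorField x) (mdifferentiableAt_mulInvariantVectorField y)
      (fun g => U.apply_derivVec x φ.2 g) (fun g => U.apply_derivVec y φ.2 g)
      (hd x φ) (hd y φ) rfl
      (congrArg (mfderiv 𝓘(ℝ, E) 𝓘(ℝ, H) (fun g => U.toHom g (U.derivVec y (φ : H))) (1 : G))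
        (one x).symm)
      (congrArg (mfderiv 𝓘(ℝ, E) 𝓘(ℝ, H) (fun g => U.toHom g (U.derivVec x (φ : H))) (1 : G))
        (one y).symm)

/-- The infinitesimal representation of the (complex) universal enveloping algebra
`ℂ ⊗ U(𝔤)` on `D^∞(U)`: the unique extension of `x ↦ dU(x)` to an algebra homomorphism. -/
def UnitaryRep.envelopingRep (U : UnitaryRep G H) :
    ℂ ⊗[ℝ] UniversalEnvelopingAlgebra ℝ (GroupLieAlgebra 𝓘(ℝ, E) G) →ₐ[ℂ]
      Module.End ℂ (U.smoothVectors E) :=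
  Algebra.TensorProduct.lift (Algebra.ofId ℂ _)
    (UniversalEnvelopingAlgebra.lift ℝ U.lieHom)
    (fun c _ => Algebra.commutes c _)

/-- The algebra of operators `dU(E(G))` on `D^∞(U)`: the image of the complex universal enveloping
algebra under the infinitesimal representation. -/
def UnitaryRep.envelopingAlgebra (E : Type*) [NormedAddCommGroup E] [NormedSpace ℝ E]
    [ChartedSpace E G] [LieGroup 𝓘(ℝ, E) ∞ G] [FiniteDimensional ℝ E] (U : UnitaryRep G H) :
    Subalgebra ℂ (Module.End ℂ (U.smoothVectors E)) :=
  (U.envelopingRep (E := E)).range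

end Rep

/-! ### Essential self-adjointness, trace class operators and states -/

section States
variable {H : Type*} [NormedAddCommGroup H] [InnerProductSpace ℂ H] [CompleteSpace H]

/-- An operator `A : D → D`, regarded as an unbounded operator in `H` with domain `D`, is
essentially self-adjoint: it is closable and its closure is self-adjoint. -/
def IsEssentiallySelfAdjoint {D : Submodule ℂ H} (A : Module.End ℂ D) : Prop :=
  (LinearPMap.mk D (D.subtype ∘ₗ A)).IsClosable ∧
    IsSelfAdjoint (LinearPMap.mk D (D.subtype ∘ₗ A)).closure

/-- `T` is trace class: `Tr |T| < ∞`, the trace of `|T| = (T* T)^(1/2)` being the sum of its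
diagonal entries in an orthonormal basis (every orthonormal basis gives the same sum). -/
def IsTraceClass (T : H →L[ℂ] H) : Prop :=
  ∀ (s : Set H) (b : HilbertBasis s ℂ H), Summable fun i => (⟪b i, CFC.abs T (b i)⟫_ℂ).re

/-- An orthonormal basis of `H`. -/
def traceBasis (H : Type*) [NormedAddCommGroup H] [InnerProductSpace ℂ H] [CompleteSpace H] :
    HilbertBasis (exists_hilbertBasis ℂ H).choose ℂ H :=
  (exists_hilbertBasis ℂ H).choose_spec.choose

/-- The trace of an operator on `H`. For trace class operators it does not depend on the
orthonormal basis. -/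
def opTrace (T : H →ₗ[ℂ] H) : ℂ :=
  ∑' i, ⟪traceBasis H i, T (traceBasis H i)⟫_ℂ

variable {D : Submodule ℂ H}

/-- The product `A T`, defined on all of `H`, when `T` maps `H` into the domain `D` of `A`. -/
def compOp (A : Module.End ℂ D) (T : H →L[ℂ] H) (hT : ∀ x, T x ∈ D) : H →ₗ[ℂ] H :=
  D.subtype ∘ₗ A ∘ₗ (T : H →ₗ[ℂ] H).codRestrict D hT

/-- `T` belongs to `T₁(𝒜)`: it is trace class, `T H ⊆ D`, `T* H ⊆ D`, and `A T` and `A T*` are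
(bounded and) trace class for all `A` in the algebra `𝒜` of operators on `D`. -/
structure MemT1 (𝒜 : Subalgebra ℂ (Module.End ℂ D)) (T : H →L[ℂ] H) : Prop where
  traceClass : IsTraceClass T
  apply_mem : ∀ x, T x ∈ D
  adjoint_apply_mem : ∀ x, T.adjoint x ∈ D
  comp_traceClass : ∀ A ∈ 𝒜, ∃ S : H →L[ℂ] H, IsTraceClass S ∧
    (S : H →ₗ[ℂ] H) = compOp A T apply_mem
  comp_adjoint_traceClass : ∀ A ∈ 𝒜, ∃ S : H →L[ℂ] H, IsTraceClass S ∧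
    (S : H →ₗ[ℂ] H) = compOp A T.adjoint adjoint_apply_mem

/-- The states on `𝒜`: the positive (in particular self-adjoint) operators in `T₁(𝒜)` that are
normalized to have trace one. -/
structure State (𝒜 : Subalgebra ℂ (Module.End ℂ D)) where
  op : H →L[ℂ] H
  mem : MemT1 𝒜 op
  isPositive : op.IsPositive
  trace_eq_one : opTrace (op : H →ₗ[ℂ] H) = 1

variable {𝒜 : Subalgebra ℂ (Module.End ℂ D)}

/-- `Tr (A ρ)`. -/
def State.expect (ρ : State 𝒜) (A : 𝒜) : ℂ :=
  opTrace (compOp (A : Module.End ℂ D) ρ.op ρ.mem.apply_mem)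

/-- The set `{ρ : |Tr (A ρ) - Tr (A ρ₀)| < ε}`. -/
def weakNhd (ρ₀ : State 𝒜) (A : 𝒜) (ε : ℝ) : Set (State 𝒜) :=
  {ρ | ‖ρ.expect A - ρ₀.expect A‖ < ε}

/-- The weak topology on the state space: the sets `weakNhd ρ₀ A ε` with `ε > 0` are an open
sub-base. -/
instance instTopologicalSpaceState : TopologicalSpace (State 𝒜) :=
  TopologicalSpace.generateFrom {N | ∃ ρ₀ A ε, 0 < ε ∧ N = weakNhd ρ₀ A ε}

theorem State.continuous_expect (A : 𝒜) : Continuous fun ρ : State 𝒜 => ρ.expect A := by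
  rw [continuous_iff_continuousAt]
  intro ρ₀
  rw [ContinuousAt, Metric.tendsto_nhds]
  intro ε hε
  have ho : IsOpen (weakNhd ρ₀ A ε) := 
    TopologicalSpace.isOpen_generateFrom_of_mem ⟨ρ₀, A, ε, hε, rfl⟩
  filter_upwards [ho.mem_nhds (by simpa [weakNhd] using hε)] with ρ hρ
  rwa [dist_eq_norm]

open TopologicalSpace (Opens)

/-- The qr-number value `a_Q(W)` of `A` on the open set `W` of states: the continuous real function
`ρ ↦ Tr (A ρ)` on `W`, a Dedekind real number to extent `W` in the topos of sheaves on the state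
space. Dedekind reals to extent `W` are ordered pointwise on `W`. The trace is real when `A` is
symmetric on `D`, which is the only case in which the definition is used. -/
def qrValue (A : 𝒜) (W : Opens (State 𝒜)) : C(W, ℝ) where
  toFun ρ := ((ρ : State 𝒜).expect A).re
  continuous_toFun :=
    Complex.continuous_re.comp ((State.continuous_expect A).comp continuous_subtype_val)

/-- `s(a)_Q(W) = (a²_Q(W) - a_Q(W)²)^(1/2)`. -/
def qrDeviation (A : 𝒜) (W : Opens (State 𝒜)) : C(W, ℝ) where
  toFun ρ := √(qrValue (A * A) W ρ - qrValue A W ρ ^ 2)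
  continuous_toFun := by fun_prop

/-- `A` is `ε`-sharp collimated in the interval `I`, with midpoint `a₀` and width `|I|`, in the
condition `W`: `|a_Q(W) - a₀| ≤ ε |I| / 2` and
`a₀ - |I| / 2 ≤ a_Q(W) - s(a)_Q(W) / √ε ≤ a_Q(W) + s(a)_Q(W) / √ε ≤ a₀ + |I| / 2`.
The middle inequality always holds and is not listed; it is not required to be strict. -/
structure IsSharplyCollimated (ε : ℝ) (A : 𝒜) (I : NonemptyInterval ℝ) (W : Opens (State 𝒜)) :
    Prop where
  abs_sub_le : ∀ ρ : W, |qrValue A W ρ - midpoint ℝ I.fst I.snd| ≤ ε * I.length / 2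
  lower_le : ∀ ρ : W, midpoint ℝ I.fst I.snd - I.length / 2 ≤
    qrValue A W ρ - qrDeviation A W ρ / √ε
  le_upper : ∀ ρ : W, qrValue A W ρ + qrDeviation A W ρ / √ε ≤
    midpoint ℝ I.fst I.snd + I.length / 2

/-- `A` is `ε`-sharp collimated in the slit `I` in the condition `W`, in the weaker sense that only
asks for `a_Q(W) ∈ I` and `a²_Q(W) - a_Q(W)² ≤ (ε / 4) |I|²`. -/
structure IsSlitCollimated (ε : ℝ) (A : 𝒜) (I : NonemptyInterval ℝ) (W : Opens (State 𝒜)) :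
    Prop where
  mem_slit : ∀ ρ : W, qrValue A W ρ ∈ Set.Icc I.fst I.snd
  variance_le : ∀ ρ : W, qrValue (A * A) W ρ - qrValue A W ρ ^ 2 ≤ ε / 4 * I.length ^ 2

end States

end QR
end

/-!
The inequality is the Robertson uncertainty relation `(Tr Cρ)² ≤ 4 Var(A) Var(B)`, valid in every
state `ρ`, combined with the fact that both kinds of collimation bound the variance of `A` by
`(ε / 4) |I|²` (`IsSharplyCollimated.variance_le`).

The Robertson relation reduces to the Cauchy-Schwarz inequality for vectors of the domain `D` once
`ρ` is written as a mixture of vector states: there are `g i ∈ D` with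
`Tr (Aρ) = ∑ ⟪g i, A (g i)⟫` for all `A` in the algebra (`State.exists_hasSum_expect`). These vectors
come from the spectral decomposition of `ρ`. A trace class operator has a compact absolute value,
because the square root of the latter is Hilbert-Schmidt, so `ρ` has an orthonormal basis of
eigenvectors, and those with a non-zero eigenvalue lie in the range of `ρ`, hence in `D`.

The trace is defined in one fixed orthonormal basis, so it has to be moved to the eigenbasis of `ρ`
(`IsTraceClass.hasSum_opTrace`). No polar decomposition is needed for this. A trace class operator
`S` maps the eigenbasis `m` of `|S|` to an absolutely summable family, as `‖S (m n)‖ = ‖|S| (m n)‖`,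
and `hasSum_inner_apply_of_summable_norm` then exchanges the order of an absolutely convergent
double series.

Essential self-adjointness enters only through the symmetry of `A` and `B` on `D`. The Robertson
relation is used as the non-negativity of the polynomial `Var(A) t² - Tr (Cρ) t + Var(B)`
(`State.variance_polynomial_nonneg`), in which the variances can be replaced by their upper bounds
before the discriminant is taken.
-/

namespace QR

section HilbertSpace
variable {H : Type*} [NormedAddCommGroup H] [InnerProductSpace ℂ H]

/-! ### Traces in two orthonormal bases -/

/-- If `S` maps the orthonormal basis `m` to an absolutely summable family, then the double series
`∑ ⟪e i, S (m n)⟫ ⟪m n, e i⟫` converges absolutely for every orthonormal basis `e`, and its two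
iterated sums are the traces of `S` in the two bases. -/
theorem hasSum_inner_apply_of_summable_norm {κ ι : Type*} (m : HilbertBasis κ ℂ H)
    (e : HilbertBasis ι ℂ H) {S : H →L[ℂ] H} (h : Summable fun n => ‖S (m n)‖) :
    HasSum (fun i => ⟪e i, S (e i)⟫_ℂ) (∑' n, ⟪m n, S (m n)⟫_ℂ) := by
  let F : κ × ι → ℂ := fun p => ⟪m p.1, e p.2⟫_ℂ * ⟪e p.2, S (m p.1)⟫_ℂ
  have hfin : ∀ n (t : Finset ι), ∑ i ∈ t, ‖F (n, i)‖ ≤ ‖S (m n)‖ := by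
    intro n t
    have h1 : √(∑ i ∈ t, ‖⟪m n, e i⟫_ℂ‖ ^ 2) ≤ 1 := by
      refine Real.sqrt_le_iff.2 ⟨zero_le_one, ?_⟩
      simpa [norm_inner_symm (m n), m.orthonormal.1 n] using
        e.orthonormal.sum_inner_products_le (m n) (s := t)
    have h2 : √(∑ i ∈ t, ‖⟪e i, S (m n)⟫_ℂ‖ ^ 2) ≤ ‖S (m n)‖ :=
      Real.sqrt_le_iff.2 ⟨norm_nonneg _, e.orthonormal.sum_inner_products_le _⟩
    calc ∑ i ∈ t, ‖F (n, i)‖ = ∑ i ∈ t, ‖⟪m n, e i⟫_ℂ‖ * ‖⟪e i, S (m n)⟫_ℂ‖ := by simp [F]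
      _ ≤ _ := Real.sum_mul_le_sqrt_mul_sqrt _ _ _
      _ ≤ 1 * ‖S (m n)‖ := by gcongr
      _ = ‖S (m n)‖ := one_mul _
  have hrow : ∀ n, Summable fun i => ‖F (n, i)‖ := fun n =>
    summable_of_sum_le (fun _ => norm_nonneg _) (hfin n)
  have hF : Summable F := by
    refine Summable.of_norm ((summable_prod_of_nonneg fun _ => norm_nonneg _).2 ⟨hrow, ?_⟩)
    exact Summable.of_nonneg_of_le (fun n => tsum_nonneg fun _ => norm_nonneg _)
      (fun n => (hrow n).tsum_le_of_sum_le (hfin n)) h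
  have hcol : ∀ i, HasSum (fun n => F (n, i)) ⟪e i, S (e i)⟫_ℂ := by
    intro i
    have := ((m.hasSum_repr (e i)).mapL S).mapL (innerSL ℂ (e i))
    simpa only [map_smul, m.repr_apply_apply, innerSL_apply_apply, smul_eq_mul] using this
  have hsum := hF.hasSum.prod_fiberwise fun n => e.hasSum_inner_mul_inner (m n) (S (m n))
  rw [hsum.tsum_eq]
  exact (Equiv.prodComm ι κ |>.hasSum_iff.2 hF.hasSum).prod_fiberwise hcol

/-! ### Compactness of trace class operators -/

/-- A finite Bessel-type bound. It makes the expansion `K = ∑ ⟪b i, ·⟫ K (b i)` of a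
Hilbert-Schmidt operator converge in operator norm. -/
theorem norm_sum_rankOne_le {ι : Type*} {b : ι → H} (hb : Orthonormal ℂ b) (v : ι → H)
    (t : Finset ι) :
    ‖∑ i ∈ t, InnerProductSpace.rankOne ℂ (v i) (b i)‖ ≤ √(∑ i ∈ t, ‖v i‖ ^ 2) := by
  refine ContinuousLinearMap.opNorm_le_bound _ (Real.sqrt_nonneg _) fun x => ?_
  have hx : √(∑ i ∈ t, ‖⟪b i, x⟫_ℂ‖ ^ 2) ≤ ‖x‖ :=
    Real.sqrt_le_iff.2 ⟨norm_nonneg x, hb.sum_inner_products_le x⟩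
  calc ‖(∑ i ∈ t, InnerProductSpace.rankOne ℂ (v i) (b i)) x‖
      = ‖∑ i ∈ t, ⟪b i, x⟫_ℂ • v i‖ := by
        simp
    _ ≤ ∑ i ∈ t, ‖v i‖ * ‖⟪b i, x⟫_ℂ‖ :=
        (norm_sum_le _ _).trans (Finset.sum_le_sum fun i _ => by rw [norm_smul, mul_comm])
    _ ≤ √(∑ i ∈ t, ‖v i‖ ^ 2) * √(∑ i ∈ t, ‖⟪b i, x⟫_ℂ‖ ^ 2) :=
        Real.sum_mul_le_sqrt_mul_sqrt _ _ _
    _ ≤ √(∑ i ∈ t, ‖v i‖ ^ 2) * ‖x‖ := by gcongr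

theorem isCompactOperator_rankOne (x y : H) :
    IsCompactOperator (InnerProductSpace.rankOne ℂ x y) :=
  (isCompactOperator_of_locallyCompactSpace_dom (innerSL ℂ y)).clm_comp
    (ContinuousLinearMap.toSpanSingleton ℂ x)

variable [CompleteSpace H]

/-- A Hilbert-Schmidt operator is compact. -/
theorem isCompactOperator_of_summable_norm_sq {ι : Type*} (b : HilbertBasis ι ℂ H)
    {K : H →L[ℂ] H} (h : Summable fun i => ‖K (b i)‖ ^ 2) : IsCompactOperator K := by
  have hs : Summable fun i => InnerProductSpace.rankOne ℂ (K (b i)) (b i) := by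
    rw [summable_iff_vanishing_norm]
    intro ε hε
    obtain ⟨s, hs⟩ := summable_iff_vanishing_norm.1 h (ε ^ 2) (by positivity)
    refine ⟨s, fun t ht => (norm_sum_rankOne_le b.orthonormal _ t).trans_lt ?_⟩
    exact (Real.sqrt_lt' hε).2 ((le_abs_self _).trans_lt (hs t ht))
  have hK : ∑' i, InnerProductSpace.rankOne ℂ (K (b i)) (b i) = K := by
    ext x
    have h1 := hs.hasSum.mapL (ContinuousLinearMap.apply ℂ H x)
    have h2 := (b.hasSum_repr x).mapL K
    simp only [map_smul, b.repr_apply_apply] at h2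
    exact h1.unique h2
  have ht := hs.hasSum
  rw [hK] at ht
  refine isCompactOperator_of_tendsto ht (Filter.Eventually.of_forall fun t => ?_)
  exact sum_mem (S := compactOperator (RingHom.id ℂ) H H)
    fun i _ => isCompactOperator_rankOne _ _

/-- A positive operator with summable diagonal is compact, because its square root is
Hilbert-Schmidt. -/
theorem isCompactOperator_of_summable_diagonal {ι : Type*} (b : HilbertBasis ι ℂ H)
    {T : H →L[ℂ] H} (hT : T.IsPositive) (h : Summable fun i => (⟪b i, T (b i)⟫_ℂ).re) :
    IsCompactOperator T := by
  have h0 : (0 : H →L[ℂ] H) ≤ T := (ContinuousLinearMap.nonneg_iff_isPositive T).2 hT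
  have hm : CFC.sqrt T * CFC.sqrt T = T := CFC.sqrt_mul_sqrt_self T h0
  have hsym : (CFC.sqrt T).IsPositive :=
    (ContinuousLinearMap.nonneg_iff_isPositive _).1 (CFC.sqrt_nonneg T)
  have hK : IsCompactOperator (CFC.sqrt T : H →L[ℂ] H) := by
    refine isCompactOperator_of_summable_norm_sq b (h.congr fun i => ?_)
    have e : ⟪b i, T (b i)⟫_ℂ = ⟪CFC.sqrt T (b i), CFC.sqrt T (b i)⟫_ℂ := by
      conv_lhs => rw [← hm]
      exact (hsym.isSymmetric _ _).symm
    rw [e, inner_self_eq_norm_sq_to_K]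
    norm_cast
  have h2 : IsCompactOperator (CFC.sqrt T * CFC.sqrt T : H →L[ℂ] H) := hK.comp_clm (CFC.sqrt T)
  rwa [hm] at h2

/-- The spectral theorem for a compact symmetric operator, in terms of an orthonormal basis of
eigenvectors. The basis is indexed by a set of vectors, as in `IsTraceClass`. -/
theorem exists_hilbertBasis_eigenvectors {T : H →L[ℂ] H} (hc : IsCompactOperator T)
    (hT : (T : H →ₗ[ℂ] H).IsSymmetric) :
    ∃ (s : Set H) (b : HilbertBasis s ℂ H), ∀ i, ∃ μ : ℂ, T (b i) = μ • b i := by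
  let V : ℂ → Submodule ℂ H := fun μ => Module.End.eigenspace (T : Module.End ℂ H) μ
  have hV : ∀ μ, CompleteSpace (V μ) := fun μ => by
    have : IsClosed ((V μ : Submodule ℂ H) : Set H) := by
      have e : ((V μ : Submodule ℂ H) : Set H) = {x | T x = μ • x} := by
        ext x
        simp [V]
      rw [e]
      exact isClosed_eq T.continuous (continuous_id.const_smul μ)
    exact this.completeSpace_coe
  choose w bw hw using fun μ => exists_hilbertBasis ℂ (V μ)
  have ho : Orthonormal ℂ fun a : Σ μ, w μ => ((bw a.1 a.2 : V a.1) : H) :=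
    hT.orthogonalFamily_eigenspaces.orthonormal_sigma_orthonormal
      fun μ => (bw μ).orthonormal
  have hsp : (Submodule.span ℂ (Set.range
      (Subtype.val : Set.range (fun a : Σ μ, w μ => ((bw a.1 a.2 : V a.1) : H)) → H)))ᗮ = ⊥ := by
    rw [Subtype.range_coe, eq_bot_iff,
      ← ContinuousLinearMap.orthogonalComplement_iSup_eigenspaces_eq_bot hc hT]
    intro x hx
    rw [← Submodule.iInf_orthogonal, Submodule.mem_iInf]
    intro μ
    rw [Submodule.mem_orthogonal]
    intro u hu
    have h1 : ∀ i, ⟪((bw μ i : V μ) : H), x⟫_ℂ = 0 := fun i =>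
      (Submodule.mem_orthogonal _ _).1 hx _ (Submodule.subset_span ⟨⟨μ, i⟩, rfl⟩)
    have h2 := (((bw μ).hasSum_repr ⟨u, hu⟩).mapL (V μ).subtypeL).mapL (innerSL ℂ x)
    have h3 : ∀ i, innerSL ℂ x ((V μ).subtypeL ((bw μ).repr ⟨u, hu⟩ i • bw μ i)) = 0 := by
      intro i
      simp [inner_eq_zero_symm.1 (h1 i)]
    simp only [h3] at h2
    exact inner_eq_zero_symm.1 (h2.unique hasSum_zero)
  refine ⟨_, HilbertBasis.mkOfOrthogonalEqBot ho.toSubtypeRange hsp, ?_⟩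
  rintro ⟨-, ⟨μ, i⟩, rfl⟩
  refine ⟨μ, ?_⟩
  rw [HilbertBasis.coe_mkOfOrthogonalEqBot]
  exact Module.End.mem_eigenspace_iff.1 (bw μ i).2

theorem IsTraceClass.exists_eigenbasis_abs {S : H →L[ℂ] H} (hS : IsTraceClass S) :
    ∃ (s : Set H) (m : HilbertBasis s ℂ H), ∀ i, ∃ μ : ℂ, CFC.abs S (m i) = μ • m i := by
  have hp : (CFC.abs S).IsPositive :=
    (ContinuousLinearMap.nonneg_iff_isPositive _).1 (CFC.abs_nonneg S)
  exact exists_hilbertBasis_eigenvectors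
    (isCompactOperator_of_summable_diagonal (traceBasis H) hp (hS _ _)) hp.isSymmetric

/-! ### Basis independence of the trace -/

theorem norm_abs_apply (S : H →L[ℂ] H) (x : H) : ‖CFC.abs S x‖ = ‖S x‖ := by
  have hp : (CFC.abs S).IsPositive :=
    (ContinuousLinearMap.nonneg_iff_isPositive _).1 (CFC.abs_nonneg S)
  have h1 : ⟪CFC.abs S x, CFC.abs S x⟫_ℂ = ⟪S x, S x⟫_ℂ := by
    have e : CFC.abs S (CFC.abs S x) = S.adjoint (S x) := by
      rw [← ContinuousLinearMap.star_eq_adjoint, ← mul_apply_eq_comp,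
        ← mul_apply_eq_comp, CFC.abs_mul_abs]
    have e' : ⟪CFC.abs S x, CFC.abs S x⟫_ℂ = ⟪x, CFC.abs S (CFC.abs S x)⟫_ℂ :=
      hp.isSymmetric _ _
    rw [e', e, ContinuousLinearMap.adjoint_inner_right]
  rw [inner_self_eq_norm_sq_to_K, inner_self_eq_norm_sq_to_K] at h1
  have h2 : ‖CFC.abs S x‖ ^ 2 = ‖S x‖ ^ 2 := by exact_mod_cast h1
  exact (pow_left_inj₀ (norm_nonneg _) (norm_nonneg _) two_ne_zero).1 h2

open scoped ComplexOrder in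
/-- A trace class operator maps some orthonormal basis, namely one that diagonalizes its absolute
value, to an absolutely summable family. -/
theorem IsTraceClass.exists_summable_norm {S : H →L[ℂ] H} (hS : IsTraceClass S) :
    ∃ (s : Set H) (m : HilbertBasis s ℂ H), Summable fun n => ‖S (m n)‖ := by
  obtain ⟨s, m, hm⟩ := hS.exists_eigenbasis_abs
  refine ⟨s, m, (hS s m).congr fun n => ?_⟩
  obtain ⟨μ, hμ⟩ := hm n
  have hp : (CFC.abs S).IsPositive :=
    (ContinuousLinearMap.nonneg_iff_isPositive _).1 (CFC.abs_nonneg S)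
  have hn : ‖m n‖ = 1 := m.orthonormal.1 n
  have h1 : ⟪m n, CFC.abs S (m n)⟫_ℂ = μ := by
    rw [hμ, inner_smul_right, inner_self_eq_norm_sq_to_K, hn]
    simp
  have h2 : 0 ≤ μ := h1 ▸ hp.inner_nonneg_right (m n)
  rw [h1, ← norm_abs_apply, hμ, norm_smul, hn, mul_one]
  exact congrArg Complex.re (Complex.eq_coe_norm_of_nonneg h2)

/-- The trace of a trace class operator may be computed in any orthonormal basis. -/
theorem IsTraceClass.hasSum_opTrace {S : H →L[ℂ] H} (hS : IsTraceClass S) {ι : Type*}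
    (e : HilbertBasis ι ℂ H) :
    HasSum (fun i => ⟪e i, S (e i)⟫_ℂ) (opTrace (S : H →ₗ[ℂ] H)) := by
  obtain ⟨s, m, hm⟩ := hS.exists_summable_norm
  have h : opTrace (S : H →ₗ[ℂ] H) = ∑' n, ⟪m n, S (m n)⟫_ℂ :=
    (hasSum_inner_apply_of_summable_norm m (traceBasis H) hm).tsum_eq
  rw [h]
  exact hasSum_inner_apply_of_summable_norm m e hm

/-! ### States as mixtures of vector states -/

variable {D : Submodule ℂ H} {𝒜 : Subalgebra ℂ (Module.End ℂ D)}

open scoped ComplexOrder in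
/-- A state is a mixture of vector states: if `ρ = ∑ λ i |f i⟩⟨f i|` is the spectral decomposition
of the density operator, then the vectors `g i = √(λ i) f i` lie in the domain `D`, and
`Tr (A ρ) = ∑ ⟪g i, A (g i)⟫` for all `A` in the algebra. -/
theorem State.exists_hasSum_expect (ρ : State 𝒜) :
    ∃ (s : Set H) (g : s → D), ∀ A : 𝒜,
      HasSum (fun i => ⟪(g i : H), ((A : Module.End ℂ D) (g i) : H)⟫_ℂ) (ρ.expect A) := by
  have h0 : (0 : H →L[ℂ] H) ≤ ρ.op :=
    (ContinuousLinearMap.nonneg_iff_isPositive _).2 ρ.isPositive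
  obtain ⟨s, f, hf⟩ := ρ.mem.traceClass.exists_eigenbasis_abs
  rw [CFC.abs_of_nonneg ρ.op h0] at hf
  have hf' : ∀ i, ∃ r : ℝ, 0 ≤ r ∧ ρ.op (f i) = (r : ℂ) • f i := by
    intro i
    obtain ⟨μ, hμ⟩ := hf i
    have h1 : ⟪f i, ρ.op (f i)⟫_ℂ = μ := by
      rw [hμ, inner_smul_right, inner_self_eq_norm_sq_to_K, f.orthonormal.1 i]
      simp
    have h2 : 0 ≤ μ := h1 ▸ ρ.isPositive.inner_nonneg_right (f i)
    exact ⟨‖μ‖, norm_nonneg μ, by rw [hμ, ← Complex.eq_coe_norm_of_nonneg h2]⟩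
  choose r hr hfr using hf'
  -- For `r i = 0` the convention `0⁻¹ = 0` gives the zero vector, as it should.
  obtain ⟨g, hgr⟩ : ∃ g : s → D, ∀ i,
      g i = (√(r i) : ℂ)⁻¹ • ⟨ρ.op (f i), ρ.mem.apply_mem _⟩ := ⟨_, fun _ => rfl⟩
  have hsq : ∀ i, (√(r i) : ℂ) * √(r i) = r i := fun i => by
    exact_mod_cast Real.mul_self_sqrt (hr i)
  have hg : ∀ i, (g i : H) = (√(r i) : ℂ) • f i := by
    intro i
    have e : (g i : H) = (√(r i) : ℂ)⁻¹ • ρ.op (f i) := by rw [hgr]; rfl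
    rw [e, hfr, smul_smul, ← hsq i]
    by_cases hz : (√(r i) : ℂ) = 0
    · simp [hz]
    · rw [inv_mul_cancel_left₀ hz]
  have hρ : ∀ i, (⟨ρ.op (f i), ρ.mem.apply_mem _⟩ : D) = (√(r i) : ℂ) • g i := by
    intro i
    apply Subtype.ext
    rw [Submodule.coe_smul, hg, smul_smul, hsq]
    exact hfr i
  refine ⟨s, g, fun A => ?_⟩
  obtain ⟨S, hS, hSA⟩ := ρ.mem.comp_traceClass A A.2
  have h := hS.hasSum_opTrace f
  rw [hSA] at h
  refine h.congr_fun fun i => ?_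
  have e : S (f i) = (((A : Module.End ℂ D) ⟨ρ.op (f i), ρ.mem.apply_mem _⟩ : D) : H) :=
    LinearMap.congr_fun hSA (f i)
  rw [e, hρ, map_smul, Submodule.coe_smul, inner_smul_right, hg, inner_smul_left]
  simp

theorem State.expect_one (ρ : State 𝒜) : ρ.expect 1 = 1 := ρ.trace_eq_one

/-! ### The Robertson inequality -/

/-- An essentially self-adjoint operator is symmetric. -/
theorem IsEssentiallySelfAdjoint.inner_apply_left {A : Module.End ℂ D}
    (hA : IsEssentiallySelfAdjoint A) (x y : D) :
    ⟪(A x : H), (y : H)⟫_ℂ = ⟪(x : H), (A y : H)⟫_ℂ := by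
  set T := LinearPMap.mk D (D.subtype ∘ₗ A)
  have hsa := hA.2
  have hle : T ≤ T.closure := T.le_closure
  have hform := LinearPMap.adjoint_isFormalAdjoint hsa.dense_domain
  rw [LinearPMap.isSelfAdjoint_def.1 hsa] at hform
  have key := hform ⟨x, hle.1 x.2⟩ ⟨y, hle.1 y.2⟩
  have ex : (A x : H) = T.closure ⟨x, hle.1 x.2⟩ := hle.2 (x := x) rfl
  have ey : (A y : H) = T.closure ⟨y, hle.1 y.2⟩ := hle.2 (x := y) rfl
  rw [ex, ey]
  exact key

/-- The Robertson inequality `(Tr (C ρ))² ≤ 4 Var(A) Var(B)` for `i C = [A, B]`, in the equivalent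
form that the polynomial `Var(A) t² - Tr (C ρ) t + Var(B)` is non-negative: its value at `t` is
`∑ ‖t (A - a) (g i) + i (B - b) (g i)‖²`, where `a` and `b` are the expectations of `A` and `B` and
the state is the mixture of the `g i`. -/
theorem State.variance_polynomial_nonneg (ρ : State 𝒜) {A B C : 𝒜}
    (hA : IsEssentiallySelfAdjoint (A : Module.End ℂ D))
    (hB : IsEssentiallySelfAdjoint (B : Module.End ℂ D))
    (hC : Complex.I • C = A * B - B * A) (t : ℝ) :
    0 ≤ ((ρ.expect (A * A)).re - (ρ.expect A).re ^ 2) * t ^ 2 - (ρ.expect C).re * t +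
      ((ρ.expect (B * B)).re - (ρ.expect B).re ^ 2) := by
  obtain ⟨s, g, hg⟩ := ρ.exists_hasSum_expect
  have hre : ∀ X : 𝒜, HasSum (fun i => (⟪(g i : H), ((X : Module.End ℂ D) (g i) : H)⟫_ℂ).re)
      (ρ.expect X).re := fun X => Complex.hasSum_re (hg X)
  set a := (ρ.expect A).re
  set b := (ρ.expect B).re
  have h1 := hre 1
  rw [ρ.expect_one, Complex.one_re] at h1
  have hs := ((((hre (A * A)).sub ((hre A).mul_left (2 * a))).add (h1.mul_left (a ^ 2))).mul_left
    (t * t)).add (((hre C).mul_left (-t)).add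
      (((hre (B * B)).sub ((hre B).mul_left (2 * b))).add (h1.mul_left (b ^ 2))))
  have hnn := hs.nonneg fun i => ?_
  · calc (0 : ℝ) ≤ _ := hnn
      _ = _ := by simp only [a, b]; ring
  · set x : H := (g i : H)
    set u : H := ((A : Module.End ℂ D) (g i) : H)
    set v : H := ((B : Module.End ℂ D) (g i) : H)
    have eAA : ⟪x, (((A * A : 𝒜) : Module.End ℂ D) (g i) : H)⟫_ℂ = ⟪u, u⟫_ℂ :=
      (hA.inner_apply_left (g i) ((A : Module.End ℂ D) (g i))).symm
    have eBB : ⟪x, (((B * B : 𝒜) : Module.End ℂ D) (g i) : H)⟫_ℂ = ⟪v, v⟫_ℂ :=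
      (hB.inner_apply_left (g i) ((B : Module.End ℂ D) (g i))).symm
    have eAB : ⟪x, ((A : Module.End ℂ D) ((B : Module.End ℂ D) (g i)) : H)⟫_ℂ = ⟪u, v⟫_ℂ :=
      (hA.inner_apply_left (g i) ((B : Module.End ℂ D) (g i))).symm
    have eBA : ⟪x, ((B : Module.End ℂ D) ((A : Module.End ℂ D) (g i)) : H)⟫_ℂ = ⟪v, u⟫_ℂ :=
      (hB.inner_apply_left (g i) ((A : Module.End ℂ D) (g i))).symm
    have eA : ⟪u, x⟫_ℂ = ⟪x, u⟫_ℂ := hA.inner_apply_left (g i) (g i)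
    have eB : ⟪v, x⟫_ℂ = ⟪x, v⟫_ℂ := hB.inner_apply_left (g i) (g i)
    have e1 : ⟪x, (((1 : 𝒜) : Module.End ℂ D) (g i) : H)⟫_ℂ = ⟪x, x⟫_ℂ := rfl
    have eC : Complex.I * ⟪x, ((C : Module.End ℂ D) (g i) : H)⟫_ℂ = ⟪u, v⟫_ℂ - ⟪v, u⟫_ℂ := by
      have := congrArg (fun X : 𝒜 => ⟪x, ((X : Module.End ℂ D) (g i) : H)⟫_ℂ) hC
      rw [← eAB, ← eBA, ← inner_sub_right, ← inner_smul_right]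
      exact this
    have hvim : (⟪v, u⟫_ℂ).im = -(⟪u, v⟫_ℂ).im := inner_im_symm (𝕜 := ℂ) v u
    have eC' : (⟪x, ((C : Module.End ℂ D) (g i) : H)⟫_ℂ).re = 2 * (⟪u, v⟫_ℂ).im := by
      have h2 := congrArg Complex.im eC
      simp only [Complex.I_mul_im, Complex.sub_im, hvim] at h2
      linarith
    have hpos : 0 ≤ (⟪(t : ℂ) • (u - (a : ℂ) • x) + Complex.I • (v - (b : ℂ) • x),
        (t : ℂ) • (u - (a : ℂ) • x) + Complex.I • (v - (b : ℂ) • x)⟫_ℂ).re :=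
      inner_self_nonneg (𝕜 := ℂ)
    have hAim : (⟪x, u⟫_ℂ).im = 0 := by
      rw [← Complex.conj_eq_iff_im, inner_conj_symm, eA]
    have hBim : (⟪x, v⟫_ℂ).im = 0 := by
      rw [← Complex.conj_eq_iff_im, inner_conj_symm, eB]
    have hxim : (⟪x, x⟫_ℂ).im = 0 := inner_self_im (𝕜 := ℂ) x
    rw [eAA, eBB, e1, eC']
    simp only [inner_add_left, inner_add_right, inner_sub_left, inner_sub_right,
      inner_smul_left, inner_smul_right, eA, eB] at hpos
    simp [hAim, hBim, hxim, hvim, -inner_self_eq_norm_sq_to_K] at hpos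
    linarith

variable {W : TopologicalSpace.Opens (State 𝒜)}

/-! ### Collimation bounds the product of the widths -/

/-- Sharp collimation bounds the variance in the same way as collimation in a slit: adding the two
bounds on `a ± s / √ε` gives `s / √ε ≤ |I| / 2`. -/
theorem IsSharplyCollimated.variance_le {ε : ℝ} (hε : 0 < ε) {A : 𝒜} {I : NonemptyInterval ℝ}
    (h : IsSharplyCollimated ε A I W) (ρ : W) :
    qrValue (A * A) W ρ - qrValue A W ρ ^ 2 ≤ ε / 4 * I.length ^ 2 := by
  have h1 := h.lower_le ρ
  have h2 := h.le_upper ρ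
  have h3 : qrDeviation A W ρ / √ε ≤ I.length / 2 := by linarith
  rw [div_le_iff₀ (Real.sqrt_pos.2 hε)] at h3
  have h4 : qrValue (A * A) W ρ - qrValue A W ρ ^ 2 ≤ (I.length / 2 * √ε) ^ 2 :=
    Real.sqrt_le_left (by have := I.length_nonneg; positivity) |>.1 h3
  rw [mul_pow, Real.sq_sqrt hε.le] at h4
  linarith

theorem abs_qrValue_le_of_variance_le {A B C : 𝒜}
    (hA : IsEssentiallySelfAdjoint (A : Module.End ℂ D))
    (hB : IsEssentiallySelfAdjoint (B : Module.End ℂ D))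
    (hC : Complex.I • C = A * B - B * A) {ε : ℝ} (hε : 0 < ε) {Ia Ib : NonemptyInterval ℝ} (ρ : W)
    (ha : qrValue (A * A) W ρ - qrValue A W ρ ^ 2 ≤ ε / 4 * Ia.length ^ 2)
    (hb : qrValue (B * B) W ρ - qrValue B W ρ ^ 2 ≤ ε / 4 * Ib.length ^ 2) :
    2 * |qrValue C W ρ| / ε ≤ Ia.length * Ib.length := by
  have hpoly : ∀ t : ℝ, 0 ≤ ε / 4 * Ia.length ^ 2 * (t * t) + -qrValue C W ρ * t +
      ε / 4 * Ib.length ^ 2 := by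
    intro t
    have h : 0 ≤ (qrValue (A * A) W ρ - qrValue A W ρ ^ 2) * t ^ 2 - qrValue C W ρ * t +
        (qrValue (B * B) W ρ - qrValue B W ρ ^ 2) :=
      State.variance_polynomial_nonneg (ρ : State 𝒜) hA hB hC t
    have h2 := mul_le_mul_of_nonneg_right ha (sq_nonneg t)
    linarith
  have hd := discrim_le_zero hpoly
  rw [discrim] at hd
  have hl : 0 ≤ ε / 2 * (Ia.length * Ib.length) := by
    have := Ia.length_nonneg
    have := Ib.length_nonneg
    positivity
  have hc : |qrValue C W ρ| ≤ ε / 2 * (Ia.length * Ib.length) :=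
    abs_le_of_sq_le_sq (by linarith) hl
  rw [div_le_iff₀ hε]
  linarith

end HilbertSpace
end QR

theorem mainTheorem6
    {E : Type*} [NormedAddCommGroup E] [NormedSpace ℝ E] [FiniteDimensional ℝ E]
    {G : Type*} [TopologicalSpace G] [ChartedSpace E G] [Group G] [LieGroup 𝓘(ℝ, E) ∞ G]
    {H : Type*} [NormedAddCommGroup H] [InnerProductSpace ℂ H] [CompleteSpace H]
    [TopologicalSpace.SeparableSpace H]
    (U : QR.UnitaryRep G H) (A B C : U.envelopingAlgebra E)
    (hA : QR.IsEssentiallySelfAdjoint (A : Module.End ℂ (U.smoothVectors E)))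
    (hB : QR.IsEssentiallySelfAdjoint (B : Module.End ℂ (U.smoothVectors E)))
    (hC : Complex.I • C = A * B - B * A)
    (ε : ℝ) (hε₀ : 0 < ε) (hε₁ : ε < 1) (Ia Ib : NonemptyInterval ℝ)
    (W : TopologicalSpace.Opens (QR.State (U.envelopingAlgebra E))) :
    (QR.IsSharplyCollimated ε A Ia W → QR.IsSharplyCollimated ε B Ib W →
      ∀ ρ : W, Ia.length * Ib.length ≥ 2 * |QR.qrValue C W ρ| / ε) ∧
    (QR.IsSlitCollimated ε A Ia W → QR.IsSlitCollimated ε B Ib W →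
      ∀ ρ : W, Ia.length * Ib.length ≥ 2 * |QR.qrValue C W ρ| / ε) := by
  refine ⟨fun ha hb ρ => ?_, fun ha hb ρ => ?_⟩
  · exact QR.abs_qrValue_le_of_variance_le hA hB hC hε₀ ρ (ha.variance_le hε₀ ρ)
      (hb.variance_le hε₀ ρ)
  · exact QR.abs_qrValue_le_of_variance_le hA hB hC hε₀ ρ (ha.variance_le ρ) (hb.variance_le ρ)
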